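/- Let $\mathrm{Log}$ be the principal logarithm, with $\mathrm{Arg}=\mathrm{Im}\,\mathrm{Log}\in(-\pi,\pi]$. Let $\overline{\mathbb C}_{\rm cut}$ be $\mathbb C\setminus((-\infty,0]\cup[1,\infty))$ together with two boundary points $x\pm0i$ for every $x\in(-\infty,0)\cup(1,\infty)$, and extend the principal branches of $\mathrm{Log}\,z$ and $\mathrm{Log}(1-z)$ to $\overline{\mathbb C}_{\rm cut}$ by one-sided limits. The universal abelian cover $\widehat\pi\colon\widehat{\mathbb C}\to\mathbb C\setminus\{0,1\}$ is the quotient of $\overline{\mathbb C}_{\rm cut}\times(2\mathbb Z)^2$ by the relations $(x+0i,2p,2q)\sim(x-0i,2p+2,2q)$ for $x<0$ and $(x+0i,2p,2q)\sim(x-0i,2p,2q+2)$ for $x>1$, with the topology induced by the functions $\mathrm{Log}\,z+2\pi ip$ and $-\mathrm{Log}(1-z)+2\pi iq$. Let $$\mathrm{FT}=\Bigl\{\Bigl(x,y,\tfrac yx,\tfrac{1-1/x}{1-1/y},\tfrac{1-x}{1-y}\Bigr)\Bigm| x\ne y\in\mathbb C\setminus\{0,1\}\Bigr\},$$ and let $\widehat{\mathrm{FT}}$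 be the connected component of the preimage of $\mathrm{FT}$ in $\widehat{\mathbb C}^5$ that contains all $((z_0;0,0),\dots,(z_4;0,0))$ with $(z_0,\dots,z_4)\in\mathrm{FT}$ and $\mathrm{Im}\,z_j>0$ for all $j$. The extended pre-Bloch group $\widehat{\mathcal P}(\mathbb C)$ is the free abelian group on $\widehat{\mathbb C}$ modulo the subgroup generated by all $[\widehat z_0]-[\widehat z_1]+[\widehat z_2]-[\widehat z_3]+[\widehat z_4]$ with $(\widehat z_0,\dots,\widehat z_4)\in\widehat{\mathrm{FT}}$. Write $[z;2p,2q]$ for the class of $(z;2p,2q)$, where $z\in(-\infty,0)\cup(1,\infty)$ is read as $z+0i$. Put $\{z;2p\}=[z;2p,2]-[z;2p,0]$ and $\widehat\kappa=\{\tfrac12;2\}-\{\tfrac12;0\}$, and define $\widehat\chi\colon\mathbb C^\times\to\widehat{\mathcal P}(\mathbb C)$ by $\widehat\chi(1)=0$, $\widehat\chi(-1)=\widehat\kappa$ and, for $z\ne\pm1$, $\widehat\chi(z)=\{z^2;0\}$ if $\mathrm{Arg}\,z\in(-\frac\pi2,\frac\pi2]$ and $\widehat\chi(z)=\{z^2;2\}$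 otherwise. Let $\sqrt[4]{z}$ be the fourth root with $\mathrm{Arg}\sqrt[4]{z}\in(-\frac\pi4,\frac\pi4]$. **Proposition.** Let $\mathrm{Im}\,z>0$ and $p,q\in\mathbb Z$. Then, in $\widehat{\mathcal P}(\mathbb C)$, $$\begin{aligned} \Bigl[\tfrac1z;-2p,2p+2q\Bigr]&=-[z;2p,2q]+\widehat\chi\bigl(i^p\sqrt[4]{z}\bigr),\\ \Bigl[1-\tfrac1z;-2p-2q,2p\Bigr]&=[z;2p,2q]-\widehat\chi\Bigl(e^{-\frac{\pi i}{12}(1-6p)}\sqrt[4]{z}\Bigr),\\ \Bigl[-\tfrac z{1-z};2p+2q,-2q\Bigr]&=-[z;2p,2q]+\widehat\chi\Bigl(e^{-\frac{\pi i}{12}(1+6q)}\sqrt[4]{z-1}\Bigr),\\ \Bigl[\tfrac1{1-z};2q,-2p-2q\Bigr]&=[z;2p,2q]-\widehat\chi\Bigl(e^{-\frac{\pi i}{12}(2+6q)}\sqrt[4]{z-1}\Bigr),\\ [1-z;-2q,-2p]&=-[z;2p,2q]+\widehat\chi\Bigl(e^{\frac{\pi i}{12}}\Bigr). \end{aligned}$$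 -/

import Mathlib

namespace ExtendedBloch

noncomputable section

/-- The cut plane `ℂ ∖ ((-∞, 0] ∪ [1, ∞))` together with two boundary points `x + 0i` (`upper x`)
and `x - 0i` (`lower x`) for every real `x` in `(-∞, 0) ∪ (1, ∞)`. -/
inductive CutPlane : Type
  | interior (z : ℂ) (hz : z.im ≠ 0 ∨ (0 < z.re ∧ z.re < 1)) : CutPlane
  | upper (x : ℝ) (hx : x < 0 ∨ 1 < x) : CutPlane
  | lower (x : ℝ) (hx : x < 0 ∨ 1 < x) : CutPlane

namespace CutPlane

/-- The underlying complex number. -/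
def toComplex : CutPlane → ℂ
  | interior z _ => z
  | upper x _ => (x : ℂ)
  | lower x _ => (x : ℂ)

/-- The principal branch of `Log z`, extended to the boundary points by one-sided limits. -/
def logZ : CutPlane → ℂ
  | interior z _ => Complex.log z
  | upper x _ => (Real.log |x| : ℂ) + (if x < 0 then Real.pi * Complex.I else 0)
  | lower x _ => (Real.log |x| : ℂ) - (if x < 0 then Real.pi * Complex.I else 0)

/-- The principal branch of `Log (1 - z)`, extended to the boundary points by one-sided limits;
note that `1 - (x + 0i)` lies below the real axis. -/
def logOneSub : CutPlane → ℂ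
  | interior z _ => Complex.log (1 - z)
  | upper x _ => (Real.log |1 - x| : ℂ) - (if 1 < x then Real.pi * Complex.I else 0)
  | lower x _ => (Real.log |1 - x| : ℂ) + (if 1 < x then Real.pi * Complex.I else 0)

open Classical in
/-- A complex number `z ≠ 0, 1` as a point of the completed cut plane, where a real number in
`(-∞, 0) ∪ (1, ∞)` is read as `z + 0i`. -/
def above (z : ℂ) (h0 : z ≠ 0) (h1 : z ≠ 1) : CutPlane :=
  if h : z.im ≠ 0 ∨ (0 < z.re ∧ z.re < 1) then interior z h
  else upper z.re (by
    push Not at h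
    obtain ⟨him, hre⟩ := h
    rcases lt_trichotomy z.re 0 with hlt | heq | hgt
    · exact Or.inl hlt
    · exact absurd (Complex.ext (by simpa using heq) (by simpa using him)) h0
    · rcases lt_or_eq_of_le (hre hgt) with hlt | heq
      · exact Or.inr hlt
      · exact absurd (Complex.ext (by simpa using heq.symm) (by simpa using him)) h1)

end CutPlane

/-- The gluing of the sheets. The triple `(z, p, q)` stands for `(z, 2p, 2q)`. -/
inductive SheetRel : CutPlane × ℤ × ℤ → CutPlane × ℤ × ℤ → Prop
  | neg (x : ℝ) (hx : x < 0) (p q : ℤ) :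
      SheetRel (CutPlane.upper x (Or.inl hx), p, q) (CutPlane.lower x (Or.inl hx), p + 1, q)
  | pos (x : ℝ) (hx : 1 < x) (p q : ℤ) :
      SheetRel (CutPlane.upper x (Or.inr hx), p, q) (CutPlane.lower x (Or.inr hx), p, q + 1)

/-- The universal abelian cover `Ĉ` of `ℂ ∖ {0, 1}`: the quotient by the equivalence relation
generated by the gluing. -/
def Chat : Type := Quot SheetRel

namespace Chat

/-- The point `(z; 2p, 2q)` of `Ĉ`. -/
def mk (z : CutPlane) (p q : ℤ) : Chat := Quot.mk SheetRel (z, p, q)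

/-- The covering projection `Ĉ → ℂ ∖ {0, 1}`, with values regarded in `ℂ`. -/
def proj : Chat → ℂ :=
  Quot.lift (fun a => a.1.toComplex) (by
    rintro _ _ (⟨x, hx, p, q⟩ | ⟨x, hx, p, q⟩) <;> rfl)

/-- The function `(z; 2p, 2q) ↦ Log z + 2πip`. -/
def logOne : Chat → ℂ :=
  Quot.lift (fun a => a.1.logZ + 2 * Real.pi * Complex.I * (a.2.1 : ℂ)) (by
    rintro _ _ (⟨x, hx, p, q⟩ | ⟨x, hx, p, q⟩)
    · simp only [CutPlane.logZ, if_pos hx]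
      push_cast
      ring
    · have h : ¬ x < 0 := by linarith
      simp only [CutPlane.logZ, if_neg h]
      ring)

/-- The function `(z; 2p, 2q) ↦ -Log (1 - z) + 2πiq`. -/
def logTwo : Chat → ℂ :=
  Quot.lift (fun a => -a.1.logOneSub + 2 * Real.pi * Complex.I * (a.2.2 : ℂ)) (by
    rintro _ _ (⟨x, hx, p, q⟩ | ⟨x, hx, p, q⟩)
    · have h : ¬ 1 < x := by linarith
      simp only [CutPlane.logOneSub, if_neg h]
      ring
    · simp only [CutPlane.logOneSub, if_pos hx]
      push_cast
      ring)

/-- The topology of the cover. The two functions above identify `Ĉ` with the closed complex curve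
`{(u, v) | exp u + exp (-v) = 1}` in `ℂ × ℂ`, which covers `ℂ ∖ {0, 1}` by `(u, v) ↦ exp u`. -/
instance : TopologicalSpace Chat :=
  TopologicalSpace.induced (fun w => (logOne w, logTwo w)) inferInstance

end Chat

/-- The set `FT` of five term relations. -/
def FT : Set (Fin 5 → ℂ) :=
  {z | ∃ x y : ℂ, x ≠ 0 ∧ x ≠ 1 ∧ y ≠ 0 ∧ y ≠ 1 ∧ x ≠ y ∧
    z = ![x, y, y / x, (1 - 1 / x) / (1 - 1 / y), (1 - x) / (1 - y)]}

/-- The part of `FT` with all five entries in the upper half plane. -/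
def FTplus : Set (Fin 5 → ℂ) := {z | z ∈ FT ∧ ∀ i, 0 < (z i).im}

/-- The preimage of `FT` in `Ĉ⁵`. -/
def FTpreimage : Set (Fin 5 → Chat) := {w | (fun i => (w i).proj) ∈ FT}

/-- The points `((z₀; 0, 0), …, (z₄; 0, 0))` with `(z₀, …, z₄)` in `FTplus`. -/
def FThatPlus : Set (Fin 5 → Chat) :=
  {w | ∃ (z : Fin 5 → ℂ) (hz : z ∈ FTplus),
    w = fun i => Chat.mk (CutPlane.interior (z i) (Or.inl (hz.2 i).ne')) 0 0}

/-- The connected component of the preimage of `FT` in `Ĉ⁵` that contains the (connected) set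
`FThatPlus`. -/
def FThat : Set (Fin 5 → Chat) :=
  {w | ∃ w₀ ∈ FThatPlus, w ∈ connectedComponentIn FTpreimage w₀}

/-- The map `ρ̂ : ℤ[FThat] → ℤ[Ĉ]`. -/
def rhoHat : FreeAbelianGroup FThat →+ FreeAbelianGroup Chat :=
  FreeAbelianGroup.lift fun w =>
    FreeAbelianGroup.of (w.1 0) - FreeAbelianGroup.of (w.1 1) + FreeAbelianGroup.of (w.1 2)
      - FreeAbelianGroup.of (w.1 3) + FreeAbelianGroup.of (w.1 4)

/-- The extended pre-Bloch group `P̂(ℂ)`. -/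
abbrev Phat : Type := FreeAbelianGroup Chat ⧸ rhoHat.range

open Classical in
/-- `symb z p q` is the class `[z; 2p, 2q]` in `P̂(ℂ)` for `z ≠ 0, 1`, where a real number `z` in
`(-∞, 0) ∪ (1, ∞)` is read as `z + 0i`. (The value at `z = 0, 1` is irrelevant.) -/
def symb (z : ℂ) (p q : ℤ) : Phat :=
  if h : z ≠ 0 ∧ z ≠ 1 then
    QuotientAddGroup.mk (FreeAbelianGroup.of (Chat.mk (CutPlane.above z h.1 h.2) p q))
  else 0

/-- `brace z p` is the element `{z; 2p} = [z; 2p, 2q] - [z; 2p, 2(q - 1)]`. It does not depend on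
`q`, and is defined here with `q = 1`. -/
def brace (z : ℂ) (p : ℤ) : Phat := symb z p 1 - symb z p 0

/-- The element `κ̂ = {z; 2p} - {z; 2(p - 1)}`. It depends neither on `z` nor on `p`, and is
defined here with `z = 1/2` and `p = 1`. -/
def kappaHat : Phat := brace (1 / 2) 1 - brace (1 / 2) 0

open Classical in
/-- The map `χ̂ : ℂˣ → P̂(ℂ)`. (The value at `z = 0` is irrelevant.) -/
def chiHat (z : ℂ) : Phat :=
  if z = 1 then 0
  else if z = -1 then kappaHat
  else if z.arg ∈ Set.Ioc (-(Real.pi / 2)) (Real.pi / 2) then brace (z ^ 2) 0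
  else brace (z ^ 2) 1

/-- The standard fourth root, with argument in `(-π/4, π/4]`. -/
def fourthRoot (z : ℂ) : ℂ := z ^ (1 / 4 : ℂ)

end

end ExtendedBloch

/-! A point of `Ĉ` amounts to a pair `(u, v)` with `exp u + exp (-v) = 1`: `u` is a logarithm of `z`
and `-v` one of `1 - z`. In these coordinates a lifted five term relation is given by logarithms of
`x`, `1 - x`, `y`, `1 - y`, `x - y`, the cross ratios having integral linear combinations of them as
logarithms. Any choice of the five logarithms is allowed, because the space of all choices is
connected: each of the five functions can be made to wind once around `0` while the others do not
wind (`single_mem_monodromy`). This yields `five_term`, a relation with free branches.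

The rest compares instances of this relation that share terms. Shifting second logarithms by `2πi`
shows that `[u, v] - [u, v - 2πi]` depends additively on `u` alone and extends to a homomorphism
`braceHom` on `ℂ`; shifting first logarithms shows that it kills `4πi`, so `χ̂ (exp s) = braceHom (2
* s)` makes sense (`chiHat_exp`). Inverting the arguments gives `[u, v] + [1/(u, v)] = braceHom (u /
2)` (`invSum_eq`). The substitution `(x, y) ↦ (1 - y, 1 - x)` shows that the sum over `z` and `1 -
z` is constant, and the sixth root of unity `exp (πi / 3)`, where `1 - z = 1 / z`, gives its value
(`pt_one_sub`). These two involutions generate the remaining symmetries, and for `Im z > 0` the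
principal logarithms turn them into the five formulas. -/

namespace ExtendedBloch

open Complex

noncomputable section

/-! ### Connectedness of the space of logarithms of pairs -/

/-- The logarithms of `x`, `1 - x`, `y`, `1 - y` and `x - y`, for `x ≠ y` in `ℂ ∖ {0, 1}`: the
universal abelian cover of the space of pairs of distinct points of `ℂ ∖ {0, 1}`. -/
def logPairs : Set (Fin 5 → ℂ) :=
  {b | exp (b 0) + exp (b 1) = 1 ∧ exp (b 2) + exp (b 3) = 1 ∧ exp (b 0) - exp (b 2) = exp (b 4)}

/-- The functions on the space of pairs whose logarithms are the coordinates of `logPairs`. -/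
def pairForms (c : ℂ × ℂ) : Fin 5 → ℂ := ![c.1, 1 - c.1, c.2, 1 - c.2, c.1 - c.2]

/-- Pairs of distinct points of `ℂ ∖ {0, 1}`. -/
def distinctPairs : Set (ℂ × ℂ) := {c | ∀ i, pairForms c i ≠ 0}

theorem mem_logPairs_iff {b : Fin 5 → ℂ} :
    b ∈ logPairs ↔ ∃ c, ∀ i, exp (b i) = pairForms c i := by
  constructor
  · rintro ⟨h1, h2, h3⟩
    refine ⟨(exp (b 0), exp (b 2)), fun i => ?_⟩
    fin_cases i <;> simp [pairForms]
    · linear_combination h1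
    · linear_combination h2
    · exact h3.symm
  · rintro ⟨c, h⟩
    have h0 := h 0
    have h1 := h 1
    have h2 := h 2
    have h3 := h 3
    have h4 := h 4
    simp only [pairForms] at h0 h1 h2 h3 h4
    refine ⟨?_, ?_, ?_⟩ <;> simp [h0, h1, h2, h3, h4]

theorem pairForms_continuous (i : Fin 5) : Continuous fun c => pairForms c i := by
  fin_cases i <;> simp [pairForms] <;> fun_prop

theorem exists_log_path (f : C(unitInterval, ℂ)) (hf : ∀ t, f t ≠ 0) (a : ℂ) (ha : exp a = f 0) :
    ∃ g : C(unitInterval, ℂ), g 0 = a ∧ ∀ t, exp (g t) = f t := by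
  obtain ⟨g, hg, h0⟩ := isCoveringMap_exp.exists_path_lifts
    (⟨fun t => ⟨f t, hf t⟩, by fun_prop⟩ : C(unitInterval, {z : ℂ // z ≠ 0})) a
    (Subtype.ext ha.symm)
  exact ⟨g, h0, fun t => congrArg Subtype.val (congrFun hg t)⟩

theorem exists_joinedIn_logPairs {c d : ℂ × ℂ} (h : JoinedIn distinctPairs c d) {b : Fin 5 → ℂ}
    (hb : ∀ i, exp (b i) = pairForms c i) :
    ∃ b', JoinedIn logPairs b b' ∧ ∀ i, exp (b' i) = pairForms d i := by
  obtain ⟨γ, hγ⟩ := h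
  choose g hg0 hg using fun i => exists_log_path
    ⟨fun t => pairForms (γ t) i, (pairForms_continuous i).comp γ.continuous⟩ (fun t => hγ t i)
    (b i) (by simpa using hb i)
  refine ⟨fun i => g i 1, ⟨⟨⟨fun t i => g i t, by fun_prop⟩, funext hg0, rfl⟩, fun t => ?_⟩,
    fun i => ?_⟩
  · exact mem_logPairs_iff.2 ⟨γ t, fun i => hg i t⟩
  · simpa using hg i 1

theorem joinedIn_compl_of_countable {s : Set ℂ} (hs : s.Countable) {a b : ℂ} (ha : a ∉ s)
    (hb : b ∉ s) : JoinedIn sᶜ a b :=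
  (hs.isPathConnected_compl_of_one_lt_rank (by simp)).joinedIn a ha b hb

theorem mem_distinctPairs {x y : ℂ} :
    (x, y) ∈ distinctPairs ↔ x ∉ ({0, 1} : Set ℂ) ∧ y ∉ ({0, 1} : Set ℂ) ∧ x ≠ y := by
  simp only [distinctPairs, Set.mem_ofPred_eq, pairForms, Fin.forall_fin_succ]
  have h (w : ℂ) : 0 = 1 - w ↔ w = 1 := by
    rw [eq_comm, sub_eq_zero, eq_comm]
  simp [sub_ne_zero, eq_comm, h]
  tauto

theorem joinedIn_distinctPairs_snd {x y y' : ℂ} (h : (x, y) ∈ distinctPairs)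
    (h' : (x, y') ∈ distinctPairs) : JoinedIn distinctPairs (x, y) (x, y') := by
  rw [mem_distinctPairs] at h h'
  have := joinedIn_compl_of_countable (s := {0, 1, x}) (Set.to_countable _) (a := y) (b := y')
    (by simp at h ⊢; tauto) (by simp at h' ⊢; tauto)
  refine (this.map (f := fun y => (x, y)) (by fun_prop)).mono ?_
  rintro _ ⟨w, hw, rfl⟩
  rw [mem_distinctPairs]
  simp at hw h ⊢
  tauto

theorem joinedIn_distinctPairs_fst {x x' y : ℂ} (h : (x, y) ∈ distinctPairs)
    (h' : (x', y) ∈ distinctPairs) : JoinedIn distinctPairs (x, y) (x', y) := by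
  rw [mem_distinctPairs] at h h'
  have := joinedIn_compl_of_countable (s := {0, 1, y}) (Set.to_countable _) (a := x) (b := x')
    (by simp at h ⊢; tauto) (by simp at h' ⊢; tauto)
  refine (this.map (f := fun x => (x, y)) (by fun_prop)).mono ?_
  rintro _ ⟨w, hw, rfl⟩
  rw [mem_distinctPairs]
  simp at hw h ⊢
  tauto

/-- One coordinate moves at a time, in the plane minus three points; the detour through `w` keeps
the coordinates distinct. -/
theorem joinedIn_distinctPairs {c d : ℂ × ℂ} (hc : c ∈ distinctPairs) (hd : d ∈ distinctPairs) :
    JoinedIn distinctPairs c d := by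
  obtain ⟨x, y⟩ := c
  obtain ⟨x', y'⟩ := d
  obtain ⟨w, hw⟩ : ∃ w : ℂ, w ∉ ({0, 1, x, x'} : Set ℂ) :=
    (Set.toFinite ({0, 1, x, x'} : Set ℂ)).exists_notMem
  have h1 : (x, w) ∈ distinctPairs := by
    rw [mem_distinctPairs] at hc ⊢
    simp at hw hc ⊢
    tauto
  have h2 : (x', w) ∈ distinctPairs := by
    rw [mem_distinctPairs] at hd ⊢
    simp at hw hd ⊢
    tauto
  exact ((joinedIn_distinctPairs_snd hc h1).trans (joinedIn_distinctPairs_fst h1 h2)).trans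
    (joinedIn_distinctPairs_snd h2 hd)

/-- Translation of `logPairs` by multiples of `2πi`. -/
def deck (n : Fin 5 → ℤ) : Fin 5 → ℂ := fun i => n i * (2 * Real.pi * I)

theorem deck_zero : deck 0 = 0 := by
  ext i
  simp [deck]

theorem deck_add (m n : Fin 5 → ℤ) : deck (m + n) = deck m + deck n := by
  ext i
  simp [deck, add_mul]

theorem exp_add_deck (b : Fin 5 → ℂ) (n : Fin 5 → ℤ) (i : Fin 5) :
    exp ((b + deck n) i) = exp (b i) := by
  simp [deck, exp_add, exp_int_mul_two_pi_mul_I]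

theorem add_deck_mem {b : Fin 5 → ℂ} (hb : b ∈ logPairs) (n : Fin 5 → ℤ) :
    b + deck n ∈ logPairs := by
  simpa only [logPairs, Set.mem_ofPred_eq, exp_add_deck] using hb

theorem JoinedIn.add_deck {b b' : Fin 5 → ℂ} (h : JoinedIn logPairs b b') (n : Fin 5 → ℤ) :
    JoinedIn logPairs (b + deck n) (b' + deck n) := by
  refine (h.map (f := fun b => b + deck n) (by fun_prop)).mono ?_
  rintro _ ⟨b, hb, rfl⟩
  exact add_deck_mem hb n

theorem exists_deck {b b' : Fin 5 → ℂ} (h : ∀ i, exp (b i) = exp (b' i)) :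
    ∃ n, b = b' + deck n := by
  choose n hn using fun i => exp_eq_exp_iff_exists_int.1 (h i)
  exact ⟨n, funext hn⟩

theorem exists_joinedIn_add_deck {b c : Fin 5 → ℂ} (hb : b ∈ logPairs) (hc : c ∈ logPairs) :
    ∃ n, JoinedIn logPairs b (c + deck n) := by
  obtain ⟨x, hx⟩ := mem_logPairs_iff.1 hb
  obtain ⟨y, hy⟩ := mem_logPairs_iff.1 hc
  obtain ⟨b', hj, hb'⟩ := exists_joinedIn_logPairs (joinedIn_distinctPairs
    (c := x) (d := y) (fun i => hx i ▸ exp_ne_zero _) (fun i => hy i ▸ exp_ne_zero _)) hx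
  obtain ⟨n, rfl⟩ := exists_deck fun i => (hb' i).trans (hy i).symm
  exact ⟨n, hj⟩

/-- The deck transformations realized by paths. -/
def monodromy : AddSubgroup (Fin 5 → ℤ) where
  carrier := {n | ∀ b ∈ logPairs, JoinedIn logPairs b (b + deck n)}
  zero_mem' := fun b hb => by
    rw [deck_zero, add_zero]
    exact JoinedIn.refl hb
  add_mem' := fun {m n} hm hn b hb => by
    rw [deck_add, ← add_assoc]
    exact (hm b hb).trans (hn _ (add_deck_mem hb m))
  neg_mem' := fun {n} hn b hb => by
    have := hn _ (add_deck_mem hb (-n))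
    rw [add_assoc, ← deck_add, neg_add_cancel, deck_zero, add_zero] at this
    exact this.symm

/-- One base point suffices: any other point is joined to a translate of `b`, and deck translations
commute and carry paths to paths. -/
theorem mem_monodromy {n : Fin 5 → ℤ} {b : Fin 5 → ℂ} (hb : JoinedIn logPairs b (b + deck n)) :
    n ∈ monodromy := fun c hc => by
  obtain ⟨m, hm⟩ := exists_joinedIn_add_deck hc hb.source_mem
  have h1 := (JoinedIn.add_deck hb m)
  have h2 := (JoinedIn.add_deck hm n)
  rw [add_right_comm] at h1
  exact (hm.trans h1).trans h2.symm

/-- A loop around the origin, starting and ending at `1 / 2`. -/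
def loop (t : ℝ) : ℂ := exp (log (1 / 2) + t * (2 * Real.pi * I))

theorem norm_loop (t : ℝ) : ‖loop t‖ = 1 / 2 := by
  have : exp (log (1 / 2)) = 1 / 2 := exp_log (by norm_num)
  rw [loop, exp_add, this, show (t : ℂ) * (2 * Real.pi * I) = ((t * (2 * Real.pi) : ℝ) : ℂ) * I by
    push_cast; ring, norm_mul, norm_exp_ofReal_mul_I]
  simp

theorem loop_continuous : Continuous loop := by
  unfold loop
  fun_prop

/-- The disc of radius `1 / 2` about `c` stays in the right half plane, so the principal logarithm
is continuous along the loop and returns to its initial value. -/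
theorem add_loop_mem (c : ℂ) (hc : 1 ≤ c.re) (s : ℂ) (hs : ‖s‖ = 1) (t : ℝ) :
    c + s * loop t ∈ slitPlane := by
  left
  have : |(s * loop t).re| ≤ 1 / 2 := by
    refine (abs_re_le_norm _).trans ?_
    rw [norm_mul, hs, norm_loop, one_mul]
  rw [add_re]
  linarith [(abs_le.1 this).1]

/-- A logarithm of `c + s * loop t`. -/
def loopLog (c s : ℂ) (t : ℝ) : ℂ := log (c + s * loop t)

theorem loop_zero_eq_one : loop 1 = loop 0 := by
  simp [loop, exp_add]

theorem loopLog_one (c s : ℂ) : loopLog c s 1 = loopLog c s 0 := by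
  simp only [loopLog, loop_zero_eq_one]

theorem exp_loopLog (c : ℂ) (hc : 1 ≤ c.re) (s : ℂ) (hs : ‖s‖ = 1) (t : ℝ) :
    exp (loopLog c s t) = c + s * loop t :=
  exp_log (slitPlane_ne_zero (add_loop_mem c hc s hs t))

theorem loopLog_continuous (c : ℂ) (hc : 1 ≤ c.re) (s : ℂ) (hs : ‖s‖ = 1) :
    Continuous (loopLog c s) :=
  Continuous.clog (by have := loop_continuous; fun_prop) (add_loop_mem c hc s hs)

theorem single_mem_monodromy_of_path (i : Fin 5) (f : ℝ → Fin 5 → ℂ) (hf : Continuous f)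
    (hmem : ∀ t, f t ∈ logPairs) (h : f 1 = f 0 + deck (Pi.single i 1)) :
    Pi.single i 1 ∈ monodromy := by
  refine mem_monodromy (b := f 0) ?_
  rw [← h]
  exact ⟨⟨⟨fun t : unitInterval => f t, by fun_prop⟩, by simp, by simp⟩, fun t => hmem t⟩

theorem single_mem_monodromy (i : Fin 5) : Pi.single i 1 ∈ monodromy := by
  have hl (t : ℝ) : exp (log (1 / 2) + t * (2 * Real.pi * I)) = loop t := rfl
  have e5 : exp (log 5) = 5 := exp_log (by norm_num)
  have e4 : exp (log (-4)) = -4 := exp_log (by norm_num)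
  have c1 := loopLog_continuous 1 (by simp) (-1) (by simp)
  have c5 := loopLog_continuous 5 (by simp) (-1) (by simp)
  have c4 := loopLog_continuous 4 (by simp) (-1) (by simp)
  have c4' := loopLog_continuous 4 (by simp) 1 (by simp)
  have x1 := exp_loopLog 1 (by simp) (-1) (by simp)
  have x5 := exp_loopLog 5 (by simp) (-1) (by simp)
  have x4 := exp_loopLog 4 (by simp) (-1) (by simp)
  have x4' := exp_loopLog 4 (by simp) 1 (by simp)
  -- In each case one of the five functions is `loop t`, the other variable is `5`, and the
  -- remaining functions are constant or, up to sign, run in a disc of radius `1 / 2` about `1`, `4`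
  -- or `5`. The summand `πi` accounts for a minus sign.
  fin_cases i
  · refine single_mem_monodromy_of_path 0 (fun t => ![log (1 / 2) + t * (2 * Real.pi * I),
      loopLog 1 (-1) t, log 5, log (-4), loopLog 5 (-1) t + Real.pi * I])
      (by fun_prop) (fun t => ?_) ?_
    · refine ⟨?_, ?_, ?_⟩ <;> simp [-one_div, hl, e5, e4, x1, x5, exp_add] <;> ring
    · ext j
      fin_cases j <;> simp [deck, loopLog_one]
  · refine single_mem_monodromy_of_path 1 (fun t => ![loopLog 1 (-1) t,
      log (1 / 2) + t * (2 * Real.pi * I), log 5, log (-4), loopLog 4 1 t + Real.pi * I])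
      (by fun_prop) (fun t => ?_) ?_
    · refine ⟨?_, ?_, ?_⟩ <;> simp [-one_div, hl, e5, e4, x1, x4', exp_add] <;> ring
    · ext j
      fin_cases j <;> simp [deck, loopLog_one]
  · refine single_mem_monodromy_of_path 2 (fun t => ![log 5, log (-4),
      log (1 / 2) + t * (2 * Real.pi * I), loopLog 1 (-1) t, loopLog 5 (-1) t])
      (by fun_prop) (fun t => ?_) ?_
    · refine ⟨?_, ?_, ?_⟩ <;> simp [-one_div, hl, e5, e4, x1, x5] <;> ring
    · ext j
      fin_cases j <;> simp [deck, loopLog_one]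
  · refine single_mem_monodromy_of_path 3 (fun t => ![log 5, log (-4),
      loopLog 1 (-1) t, log (1 / 2) + t * (2 * Real.pi * I), loopLog 4 1 t])
      (by fun_prop) (fun t => ?_) ?_
    · refine ⟨?_, ?_, ?_⟩ <;> simp [-one_div, hl, e5, e4, x1, x4'] <;> ring
    · ext j
      fin_cases j <;> simp [deck, loopLog_one]
  · refine single_mem_monodromy_of_path 4 (fun t => ![log 5, log (-4),
      loopLog 5 (-1) t, loopLog 4 (-1) t + Real.pi * I, log (1 / 2) + t * (2 * Real.pi * I)])
      (by fun_prop) (fun t => ?_) ?_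
    · refine ⟨?_, ?_, ?_⟩ <;> simp [-one_div, hl, e5, e4, x5, x4, exp_add] <;> ring
    · ext j
      fin_cases j <;> simp [deck, loopLog_one]

theorem mem_monodromy_all (n : Fin 5 → ℤ) : n ∈ monodromy := by
  rw [show n = ∑ i, n i • (Pi.single i 1 : Fin 5 → ℤ) by
    ext j
    simp [Finset.sum_apply, Pi.single_apply]]
  exact sum_mem fun i _ => zsmul_mem (single_mem_monodromy i) _

theorem joinedIn_logPairs {b c : Fin 5 → ℂ} (hb : b ∈ logPairs) (hc : c ∈ logPairs) :
    JoinedIn logPairs b c := by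
  obtain ⟨n, hn⟩ := exists_joinedIn_add_deck hb hc
  exact hn.trans (mem_monodromy_all n c hc).symm

theorem isPreconnected_logPairs : IsPreconnected logPairs := by
  rcases logPairs.eq_empty_or_nonempty with h | ⟨b, hb⟩
  · rw [h]
    exact isPreconnected_empty
  · exact (IsPathConnected.isConnected ⟨b, hb, fun _ hc => joinedIn_logPairs hb hc⟩).isPreconnected

/-! ### The cover as a curve of pairs of logarithms -/

namespace CutPlane

theorem toComplex_ne_zero (c : CutPlane) : c.toComplex ≠ 0 := by
  rintro h
  rcases c with ⟨z, hz⟩ | ⟨x, hx⟩ | ⟨x, hx⟩ <;> simp only [toComplex] at h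
  · simp [h] at hz
  all_goals
    rw [ofReal_eq_zero] at h
    rcases hx with hx | hx <;> linarith

theorem toComplex_ne_one (c : CutPlane) : 1 - c.toComplex ≠ 0 := by
  intro h
  rw [sub_eq_zero] at h
  rcases c with ⟨z, hz⟩ | ⟨x, hx⟩ | ⟨x, hx⟩ <;> simp only [toComplex] at h
  · simp [← h] at hz
  all_goals
    have h' : (1 : ℝ) = x := by exact_mod_cast h
    rcases hx with hx | hx <;> linarith

theorem log_ofReal_of_neg {x : ℝ} (hx : x < 0) :
    log (x : ℂ) = Real.log |x| + Real.pi * I := by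
  rw [log, arg_ofReal_of_neg hx, norm_real, Real.norm_eq_abs]

theorem log_ofReal_of_pos {x : ℝ} (hx : 0 < x) : log (x : ℂ) = Real.log |x| := by
  rw [abs_of_pos hx, ofReal_log hx.le]

theorem exp_log_abs_of_pos {x : ℝ} (hx : 0 < x) : exp (Real.log |x|) = x := by
  rw [← log_ofReal_of_pos hx, exp_log (by exact_mod_cast hx.ne')]

theorem exp_log_abs_of_neg {x : ℝ} (hx : x < 0) : exp (Real.log |x|) = -x := by
  rw [← abs_neg, exp_log_abs_of_pos (neg_pos.2 hx), ofReal_neg]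

theorem exp_logZ (c : CutPlane) : exp c.logZ = c.toComplex := by
  have h0 := c.toComplex_ne_zero
  rcases c with ⟨z, hz⟩ | ⟨x, hx⟩ | ⟨x, hx⟩ <;> simp only [toComplex, logZ] at h0 ⊢
  · exact exp_log h0
  all_goals
    split_ifs with h
    · simp [-Real.log_abs, exp_add, exp_sub, exp_log_abs_of_neg h]
    · simp [-Real.log_abs, exp_log_abs_of_pos (show 0 < x by rcases hx with hx | hx <;> linarith)]

theorem exp_logOneSub (c : CutPlane) : exp c.logOneSub = 1 - c.toComplex := by
  have h0 := c.toComplex_ne_one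
  rcases c with ⟨z, hz⟩ | ⟨x, hx⟩ | ⟨x, hx⟩ <;> simp only [toComplex, logOneSub] at h0 ⊢
  · exact exp_log h0
  all_goals
    split_ifs with h
    · simp [-Real.log_abs, exp_add, exp_sub, exp_log_abs_of_neg (show 1 - x < 0 by linarith),
        div_neg]
    · simp [-Real.log_abs,
        exp_log_abs_of_pos (show 0 < 1 - x by rcases hx with hx | hx <;> linarith)]

theorem above_toComplex (z : ℂ) (h0 : z ≠ 0) (h1 : z ≠ 1) : (above z h0 h1).toComplex = z := by
  unfold above
  split_ifs with h
  · rfl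
  · push Not at h
    exact Complex.ext (by simp [toComplex]) (by simp [toComplex, h.1])

theorem above_logZ (z : ℂ) (h0 : z ≠ 0) (h1 : z ≠ 1) : (above z h0 h1).logZ = log z := by
  conv_rhs => rw [← above_toComplex z h0 h1]
  unfold above
  split_ifs with h
  · rfl
  · simp only [logZ, toComplex]
    split_ifs with hx
    · rw [log_ofReal_of_neg hx]
    · have : z.re ≠ 0 := fun hre => h0 (Complex.ext hre (by simpa using (not_or.1 h).1))
      rw [log_ofReal_of_pos (lt_of_le_of_ne (not_lt.1 hx) this.symm), add_zero]

theorem above_of_im_ne_zero {z : ℂ} (h0 : z ≠ 0) (h1 : z ≠ 1) (h : z.im ≠ 0) :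
    above z h0 h1 = interior z (Or.inl h) := by
  rw [above, dif_pos (Or.inl h)]

end CutPlane

namespace Chat

theorem logOne_mk (c : CutPlane) (p q : ℤ) :
    logOne (mk c p q) = c.logZ + 2 * Real.pi * I * (p : ℂ) := rfl

theorem logTwo_mk (c : CutPlane) (p q : ℤ) :
    logTwo (mk c p q) = -c.logOneSub + 2 * Real.pi * I * (q : ℂ) := rfl

theorem exp_logOne (w : Chat) : exp (logOne w) = proj w := by
  induction w using Quot.ind with | mk a =>
  simp [logOne, proj, exp_add, CutPlane.exp_logZ, mul_comm _ (a.2.1 : ℂ),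
    exp_int_mul_two_pi_mul_I]

theorem exp_neg_logTwo (w : Chat) : exp (-logTwo w) = 1 - proj w := by
  induction w using Quot.ind with | mk a =>
  simp [logTwo, proj, exp_add, exp_neg, CutPlane.exp_logOneSub, mul_comm _ (a.2.2 : ℂ),
    exp_int_mul_two_pi_mul_I]

theorem exists_of_logs {u v : ℂ} (h : exp u + exp (-v) = 1) :
    ∃ w : Chat, logOne w = u ∧ logTwo w = v := by
  have h1 : exp u ≠ 1 := fun h1 => exp_ne_zero (-v) (by simp [h1] at h)
  set c := CutPlane.above (exp u) (exp_ne_zero u) h1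
  have hc : c.toComplex = exp u := CutPlane.above_toComplex _ _ _
  obtain ⟨p, hp⟩ := exp_eq_exp_iff_exists_int.1 (hc ▸ c.exp_logZ).symm
  obtain ⟨q, hq⟩ := exp_eq_exp_iff_exists_int.1
    (show exp c.logOneSub = exp (-v) by rw [c.exp_logOneSub, hc, ← h]; ring)
  refine ⟨mk c p q, ?_, ?_⟩ <;> simp only [logOne, logTwo, mk]
  · rw [hp]
    ring
  · rw [hq]
    ring

theorem two_pi_I_mul_inj {m n : ℤ} :
    2 * Real.pi * I * (m : ℂ) = 2 * Real.pi * I * (n : ℂ) ↔ m = n := by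
  rw [mul_right_inj' two_pi_I_ne_zero, Int.cast_inj]

/-- Equal logarithms force equal projections. Across a cut exactly one logarithm jumps, by `2πi`, so
the sheets over `x + 0i` and `x - 0i` with equal logarithms are precisely those glued together. -/
theorem ext_logs {w w' : Chat} (h1 : logOne w = logOne w') (h2 : logTwo w = logTwo w') :
    w = w' := by
  have hp : proj w = proj w' := by rw [← exp_logOne, h1, exp_logOne]
  induction w using Quot.ind with | mk a =>
  induction w' using Quot.ind with | mk a' =>
  obtain ⟨c, p, q⟩ := a
  obtain ⟨c', p', q'⟩ := a'
  have key : ∀ (x : ℝ) (hx : x < 0 ∨ 1 < x) (p q p' q' : ℤ),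
      logOne (mk (.upper x hx) p q) = logOne (mk (.lower x hx) p' q') →
      logTwo (mk (.upper x hx) p q) = logTwo (mk (.lower x hx) p' q') →
      mk (.upper x hx) p q = mk (.lower x hx) p' q' := by
    intro x hx p q p' q' h1 h2
    simp only [logOne, logTwo, mk, CutPlane.logZ, CutPlane.logOneSub] at h1 h2
    rcases hx with hx | hx
    · rw [if_pos hx] at h1
      rw [if_neg (by linarith)] at h2
      obtain rfl : p + 1 = p' := two_pi_I_mul_inj.1 (by push_cast; linear_combination h1)
      obtain rfl : q = q' := two_pi_I_mul_inj.1 (by linear_combination h2)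
      exact Quot.sound (SheetRel.neg x hx p q)
    · rw [if_neg (by linarith)] at h1
      rw [if_pos hx] at h2
      obtain rfl : p = p' := two_pi_I_mul_inj.1 (by linear_combination h1)
      obtain rfl : q + 1 = q' := two_pi_I_mul_inj.1 (by push_cast; linear_combination h2)
      exact Quot.sound (SheetRel.pos x hx p q)
  have same : c = c' → (Quot.mk SheetRel (c, p, q) : Chat) = Quot.mk SheetRel (c', p', q') := by
    rintro rfl
    simp only [logOne, logTwo, add_right_inj, two_pi_I_mul_inj] at h1 h2
    rw [h1, h2]
  have off : ∀ (z : ℂ) (hz : z.im ≠ 0 ∨ (0 < z.re ∧ z.re < 1)) (x : ℝ), (x < 0 ∨ 1 < x) →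
      z ≠ x := by
    rintro z hz x hx rfl
    simp only [ofReal_im, ne_eq, not_true_eq_false, ofReal_re, false_or] at hz
    rcases hx with hx | hx <;> linarith [hz.1, hz.2]
  rcases c with ⟨z, hz⟩ | ⟨x, hx⟩ | ⟨x, hx⟩ <;> rcases c' with ⟨z', hz'⟩ | ⟨x', hx'⟩ | ⟨x', hx'⟩ <;>
    simp only [proj, CutPlane.toComplex, ofReal_inj] at hp
  · subst hp
    exact same rfl
  · exact absurd hp (off _ hz _ hx')
  · exact absurd hp (off _ hz _ hx')
  · exact absurd hp.symm (off _ hz' _ hx)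
  · subst hp
    exact same rfl
  · subst hp
    exact key x hx p q p' q' h1 h2
  · exact absurd hp.symm (off _ hz' _ hx)
  · subst hp
    exact (key x hx p' q' p q h1.symm h2.symm).symm
  · subst hp
    exact same rfl

/-- The point of `Ĉ` with the given logarithms. -/
def ofLogs (u v : ℂ) (h : exp u + exp (-v) = 1) : Chat := (exists_of_logs h).choose

theorem logOne_ofLogs {u v : ℂ} (h : exp u + exp (-v) = 1) : logOne (ofLogs u v h) = u :=
  (exists_of_logs h).choose_spec.1

theorem logTwo_ofLogs {u v : ℂ} (h : exp u + exp (-v) = 1) : logTwo (ofLogs u v h) = v :=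
  (exists_of_logs h).choose_spec.2

theorem proj_ofLogs {u v : ℂ} (h : exp u + exp (-v) = 1) : proj (ofLogs u v h) = exp u := by
  rw [← exp_logOne, logOne_ofLogs]

theorem continuous_ofLogs {X : Type*} [TopologicalSpace X] {u v : X → ℂ} (hu : Continuous u)
    (hv : Continuous v) (h : ∀ x, exp (u x) + exp (-v x) = 1) :
    Continuous fun x => ofLogs (u x) (v x) (h x) := by
  rw [continuous_induced_rng]
  simpa only [Function.comp_def, logOne_ofLogs, logTwo_ofLogs] using hu.prodMk hv

end Chat

/-! ### Lifted five term relations -/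

/-- First logarithms of the five cross ratios attached to a point of `logPairs`. -/
def crossLogOne (b : Fin 5 → ℂ) : Fin 5 → ℂ :=
  ![b 0, b 2, b 2 - b 0, b 2 - b 0 + (b 1 - b 3), b 1 - b 3]

/-- Second logarithms of the five cross ratios attached to a point of `logPairs`. -/
def crossLogTwo (b : Fin 5 → ℂ) : Fin 5 → ℂ :=
  ![-b 1, -b 3, b 0 - b 4, b 0 - b 4 + b 3, b 3 - b 4]

/-- For the last three cross ratios, one minus the ratio is `(x - y) / x`, `(x - y) / (x * (1 - y))`
and `(x - y) / (1 - y)`. -/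
theorem crossLog_curve {b : Fin 5 → ℂ} (hb : b ∈ logPairs) (i : Fin 5) :
    exp (crossLogOne b i) + exp (-crossLogTwo b i) = 1 := by
  obtain ⟨h1, h2, h3⟩ := hb
  have n0 := exp_ne_zero (b 0)
  have n3 := exp_ne_zero (b 3)
  fin_cases i <;> simp [crossLogOne, crossLogTwo, exp_add, exp_sub, exp_neg] <;> field_simp
  · exact h1
  · exact h2
  · linear_combination -h3
  · linear_combination -h3 + exp (b 2) * h1 - exp (b 0) * h2
  · linear_combination -h3 + h1 - h2

/-- The lifted five term relation attached to a point of `logPairs`. -/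
def crossPoint (b : logPairs) : Fin 5 → Chat :=
  fun i => Chat.ofLogs (crossLogOne b i) (crossLogTwo b i) (crossLog_curve b.2 i)

theorem crossPoint_continuous : Continuous crossPoint := by
  have h (j : Fin 5) : Continuous fun b : logPairs => b.1 j :=
    (continuous_apply j).comp continuous_subtype_val
  refine continuous_pi fun i => Chat.continuous_ofLogs ?_ ?_ _
  · fin_cases i
    exacts [h 0, h 2, (h 2).sub (h 0), ((h 2).sub (h 0)).add ((h 1).sub (h 3)), (h 1).sub (h 3)]
  · fin_cases i
    exacts [(h 1).neg, (h 3).neg, (h 0).sub (h 4), ((h 0).sub (h 4)).add (h 3), (h 3).sub (h 4)]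

theorem crossPoint_mem_preimage (b : logPairs) : crossPoint b ∈ FTpreimage := by
  obtain ⟨b, h1, h2, h3⟩ := b
  have n0 := exp_ne_zero (b 0)
  have n1 := exp_ne_zero (b 1)
  have n2 := exp_ne_zero (b 2)
  have n3 := exp_ne_zero (b 3)
  have n4 := exp_ne_zero (b 4)
  have e1 : 1 - exp (b 0) = exp (b 1) := by linear_combination -h1
  have e2 : 1 - exp (b 2) = exp (b 3) := by linear_combination -h2
  refine ⟨exp (b 0), exp (b 2), n0, fun h => n1 (by rw [← e1, h, sub_self]), n2,
    fun h => n3 (by rw [← e2, h, sub_self]), sub_ne_zero.1 (h3 ▸ n4), ?_⟩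
  have e3 : (1 - 1 / exp (b 0)) / (1 - 1 / exp (b 2)) =
      exp (b 2) / exp (b 0) * (exp (b 1) / exp (b 3)) := by
    rw [← e1, ← e2]
    rw [← e1] at n1
    rw [← e2] at n3
    have : 1 - 1 / exp (b 2) ≠ 0 := by
      intro h
      apply n3
      field_simp at h
      linear_combination -h
    have : exp (b 2) - 1 ≠ 0 := by
      intro h
      exact n3 (by linear_combination -h)
    field_simp
    ring
  rw [e1, e2, e3]
  ext i
  simp only [crossPoint, Chat.proj_ofLogs]
  fin_cases i <;> simp [crossLogOne, exp_add, exp_sub]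

theorem crossPoint_mem_FThatPlus {b : Fin 5 → ℂ} (hb : b ∈ logPairs)
    (hpos : ∀ i, 0 < (exp (crossLogOne b i)).im)
    (h1 : ∀ i, (crossLogOne b i).im ∈ Set.Ioc (-Real.pi) Real.pi)
    (h2 : ∀ i, (-crossLogTwo b i).im ∈ Set.Ioc (-Real.pi) Real.pi) :
    crossPoint ⟨b, hb⟩ ∈ FThatPlus := by
  have hproj : (fun i => (crossPoint ⟨b, hb⟩ i).proj) = fun i => exp (crossLogOne b i) :=
    funext fun i => Chat.proj_ofLogs _
  refine ⟨fun i => exp (crossLogOne b i), ⟨hproj ▸ crossPoint_mem_preimage ⟨b, hb⟩, hpos⟩,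
    funext fun i => Chat.ext_logs ?_ ?_⟩
  · simp [crossPoint, Chat.logOne_ofLogs, Chat.logOne_mk, CutPlane.logZ,
      log_exp (h1 i).1 (h1 i).2]
  · have : 1 - exp (crossLogOne b i) = exp (-crossLogTwo b i) := by
      rw [← crossLog_curve hb i]
      ring
    simp [crossPoint, Chat.logTwo_ofLogs, Chat.logTwo_mk, CutPlane.logOneSub, this,
      log_exp (h2 i).1 (h2 i).2]

theorem exists_crossPoint_mem_FThatPlus : ∃ b, crossPoint b ∈ FThatPlus := by
  -- All five cross ratios of this pair lie in the upper half plane. Equal real parts make the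
  -- argument of `x - y` exactly `-π / 2`, and the signs and bounds of the other arguments keep all
  -- ten combinations in the principal range.
  obtain ⟨x, hx⟩ : ∃ x : ℂ, x = ⟨1 / 2, 1 / 2⟩ := ⟨_, rfl⟩
  obtain ⟨y, hy⟩ : ∃ y : ℂ, y = ⟨1 / 2, 1⟩ := ⟨_, rfl⟩
  have re_pos {z : ℂ} (hz : 0 < z.re) : -(Real.pi / 2) < z.arg ∧ z.arg < Real.pi / 2 :=
    abs_lt.1 (abs_arg_lt_pi_div_two_iff.2 (Or.inl hz))
  have ax : 0 ≤ x.arg := arg_nonneg_iff.2 (by norm_num [hx])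
  have ay : 0 ≤ y.arg := arg_nonneg_iff.2 (by norm_num [hy])
  have ax' : (1 - x).arg < 0 := arg_neg_iff.2 (by norm_num [hx])
  have ay' : (1 - y).arg < 0 := arg_neg_iff.2 (by norm_num [hy])
  have axy : (x - y).arg = -(Real.pi / 2) := arg_eq_neg_pi_div_two_iff.2 (by norm_num [hx, hy])
  have bx := re_pos (z := x) (by norm_num [hx])
  have cy := re_pos (z := y) (by norm_num [hy])
  have bx' := re_pos (z := 1 - x) (by norm_num [hx])
  have cy' := re_pos (z := 1 - y) (by norm_num [hy])
  have ne {z : ℂ} (hz : z.im ≠ 0) : exp (log z) = z := exp_log fun h => hz (by rw [h, zero_im])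
  have ex : exp (log x) = x := ne (by norm_num [hx])
  have ey : exp (log y) = y := ne (by norm_num [hy])
  have ex' : exp (log (1 - x)) = 1 - x := ne (by norm_num [hx])
  have ey' : exp (log (1 - y)) = 1 - y := ne (by norm_num [hy])
  have exy : exp (log (x - y)) = x - y := ne (by norm_num [hx, hy])
  refine ⟨⟨![log x, log (1 - x), log y, log (1 - y), log (x - y)], ?_⟩,
    crossPoint_mem_FThatPlus _ (fun i => ?_) (fun i => ?_) (fun i => ?_)⟩
  · refine ⟨?_, ?_, ?_⟩ <;> simp [ex, ey, ex', ey', exy]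
  · fin_cases i <;> simp [crossLogOne, exp_add, exp_sub, ex, ey, ex', ey', div_im, div_re,
      normSq_apply] <;> norm_num [hx, hy]
  · have := Real.pi_pos
    fin_cases i <;> simp [crossLogOne, log_im] <;> constructor <;> linarith
  · have := Real.pi_pos
    fin_cases i <;> simp [crossLogTwo, log_im, axy] <;> constructor <;> linarith

theorem crossPoint_mem_FThat (b : logPairs) : crossPoint b ∈ FThat := by
  obtain ⟨b₀, h₀⟩ := exists_crossPoint_mem_FThatPlus
  have : PreconnectedSpace logPairs :=
    isPreconnected_iff_preconnectedSpace.1 isPreconnected_logPairs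
  refine ⟨_, h₀, (isPreconnected_range crossPoint_continuous).subset_connectedComponentIn
    ⟨b₀, rfl⟩ ?_ ⟨b, rfl⟩⟩
  rintro _ ⟨b, rfl⟩
  exact crossPoint_mem_preimage b

/-! ### The five term relation with free branches -/

open Classical in
/-- The class in `P̂(ℂ)` of the point of `Ĉ` with logarithms `u` and `v`. -/
def pt (u v : ℂ) : Phat :=
  if h : exp u + exp (-v) = 1 then
    QuotientAddGroup.mk (FreeAbelianGroup.of (Chat.ofLogs u v h)) else 0

theorem mk_eq_pt (w : Chat) :
    (QuotientAddGroup.mk (FreeAbelianGroup.of w) : Phat) = pt w.logOne w.logTwo := by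
  have h : exp w.logOne + exp (-w.logTwo) = 1 := by
    rw [Chat.exp_logOne, Chat.exp_neg_logTwo]
    ring
  rw [pt, dif_pos h]
  congr 2
  exact Chat.ext_logs (Chat.logOne_ofLogs h).symm (Chat.logTwo_ofLogs h).symm

theorem pt_crossLog {b : Fin 5 → ℂ} (hb : b ∈ logPairs) :
    pt (crossLogOne b 0) (crossLogTwo b 0) - pt (crossLogOne b 1) (crossLogTwo b 1)
      + pt (crossLogOne b 2) (crossLogTwo b 2) - pt (crossLogOne b 3) (crossLogTwo b 3)
      + pt (crossLogOne b 4) (crossLogTwo b 4) = 0 := by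
  have := (QuotientAddGroup.eq_zero_iff _).2 (AddMonoidHom.mem_range.2
    ⟨FreeAbelianGroup.of ⟨_, crossPoint_mem_FThat ⟨b, hb⟩⟩, rfl⟩ : _ ∈ rhoHat.range)
  simp only [pt, dif_pos (crossLog_curve hb _)]
  exact this

/-- The five parameters are the free logarithms of a point of `logPairs`, with `u₀ - v₂` as that of
`x - y`; the other coordinates of the relation are then determined. -/
theorem five_term {u₀ v₀ u₁ v₁ v₂ : ℂ} (h0 : exp u₀ + exp (-v₀) = 1) (h1 : exp u₁ + exp (-v₁) = 1)
    (h2 : exp (u₁ - u₀) + exp (-v₂) = 1) :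
    pt u₀ v₀ - pt u₁ v₁ + pt (u₁ - u₀) v₂ - pt (u₁ - u₀ + (v₁ - v₀)) (v₂ - v₁)
      + pt (v₁ - v₀) (v₂ - v₁ - u₀) = 0 := by
  have hb : ![u₀, -v₀, u₁, -v₁, u₀ - v₂] ∈ logPairs := by
    refine ⟨h0, h1, ?_⟩
    simp [exp_sub, exp_neg] at h2 ⊢
    have := exp_ne_zero u₀
    have := exp_ne_zero v₂
    field_simp at h2 ⊢
    linear_combination -h2
  convert pt_crossLog hb using 2 <;> simp [crossLogOne, crossLogTwo]
  all_goals congr 1 <;> ring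

/-- The period `2πi`. -/
def period : ℂ := 2 * Real.pi * I

theorem exp_period : exp period = 1 := exp_two_pi_mul_I

theorem exp_half_period : exp (period / 2) = -1 := by
  rw [period, show 2 * Real.pi * I / 2 = Real.pi * I by ring, exp_pi_mul_I]

/-- The pairs of logarithms of points of `Ĉ`. -/
def Curve (u v : ℂ) : Prop := exp u + exp (-v) = 1

namespace Curve

variable {u v : ℂ}

theorem exp_neg_eq (h : Curve u v) : exp (-v) = 1 - exp u := by
  rw [← show exp u + exp (-v) = 1 from h]
  ring

theorem exp_ne_one (h : Curve u v) : exp u ≠ 1 := fun h1 =>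
  exp_ne_zero (-v) (by rw [h.exp_neg_eq, h1, sub_self])

theorem add_period_left (h : Curve u v) : Curve (u + period) v := by
  rw [Curve, exp_add, exp_period, mul_one]
  exact h

theorem sub_period_right (h : Curve u v) : Curve u (v - period) := by
  rw [Curve, neg_sub, sub_eq_neg_add, exp_add, exp_period, mul_one]
  exact h

theorem one_sub (h : Curve u v) : Curve (-v) (-u) := by
  rw [Curve, neg_neg, add_comm]
  exact h

theorem inv (h : Curve u v) : Curve (-u) (u + v - period / 2) := by
  rw [Curve, show -(u + v - period / 2) = -v - u + period / 2 by ring, exp_add, exp_sub,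
    h.exp_neg_eq, exp_half_period, exp_neg]
  have := exp_ne_zero u
  field_simp
  ring

theorem exists_right (h : exp u ≠ 1) : ∃ v, Curve u v :=
  ⟨-log (1 - exp u), by rw [Curve, neg_neg, exp_log (sub_ne_zero.2 h.symm)]; ring⟩

end Curve

theorem exp_ne_one_of_re_ne_zero {u : ℂ} (h : u.re ≠ 0) : exp u ≠ 1 := fun h1 => by
  have := congrArg (‖·‖) h1
  simp only [norm_exp, norm_one, Real.exp_eq_one_iff] at this
  exact h this

/-- The same relation, parametrized by its last three terms, which lie over two numbers and their
product. The second logarithms enter the first two terms only through their differences. -/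
theorem five_term_of_sum {a b v w t : ℂ} (ha : Curve a v) (hb : Curve b w) (hab : Curve (a + b) t) :
    pt (t - w) (v - t - b) - pt (a + t - w) (v - t) + pt a v - pt (a + b) t + pt b w = 0 := by
  have ea := ha.exp_neg_eq
  have eb := hb.exp_neg_eq
  have et := hab.exp_neg_eq
  rw [exp_add] at et
  have ht : exp t * exp (-t) = 1 := by rw [← exp_add, add_neg_cancel, exp_zero]
  have h := five_term (u₀ := t - w) (v₀ := v - t - b) (u₁ := a + t - w) (v₁ := v - t) (v₂ := v)
    (by
      rw [sub_eq_add_neg, exp_add, show -(v - t - b) = -v + t + b by ring, exp_add, exp_add, ea, eb]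
      rw [et] at ht
      linear_combination ht)
    (by
      rw [show a + t - w = a + t + -w by ring, exp_add, exp_add, show -(v - t) = -v + t by ring,
        exp_add, ea, eb]
      rw [et] at ht
      linear_combination ht)
    (by
      rw [show a + t - w - (t - w) = a by ring]
      exact ha)
  rwa [show a + t - w - (t - w) = a by ring, show v - t - (v - t - b) = b by ring,
    show v - (v - t) = t by ring, show t - (t - w) = w by ring] at h

theorem exists_shift (a : ℂ) : ∃ b, exp b ≠ 1 ∧ exp (a + b) ≠ 1 := by
  refine ⟨((|a.re| + 1 : ℝ) : ℂ), exp_ne_one_of_re_ne_zero ?_, exp_ne_one_of_re_ne_zero ?_⟩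
  · rw [ofReal_re]
    positivity
  · rw [add_re, ofReal_re]
    linarith [neg_abs_le a.re]

theorem eq_of_additive {A : Type*} [AddCommGroup A] {f : ℂ → ℂ → A}
    (hf : ∀ {a b v w t}, Curve a v → Curve b w → Curve (a + b) t → f a v + f b w = f (a + b) t)
    {a v v' : ℂ} (h : Curve a v) (h' : Curve a v') : f a v = f a v' := by
  obtain ⟨b, hb, hab⟩ := exists_shift a
  obtain ⟨w, hw⟩ := Curve.exists_right hb
  obtain ⟨t, ht⟩ := Curve.exists_right hab
  exact add_right_cancel ((hf h hw ht).trans (hf h' hw ht).symm)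

/-! ### The homomorphism of second sheet differences -/

/-- The difference of the classes of two points of `Ĉ` whose second logarithms differ by `2πi`. -/
def sheetDiff (u v : ℂ) : Phat := pt u v - pt u (v - period)

/-- Lowering `v`, `w` and `t` together by `2πi` leaves the first two terms of `five_term_of_sum`
unchanged, so they cancel in the difference. -/
theorem sheetDiff_add {a b v w t : ℂ} (ha : Curve a v) (hb : Curve b w) (hab : Curve (a + b) t) :
    sheetDiff a v + sheetDiff b w = sheetDiff (a + b) t := by
  have h1 := five_term_of_sum ha hb hab
  have h2 := five_term_of_sum ha.sub_period_right hb.sub_period_right hab.sub_period_right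
  rw [show t - period - (w - period) = t - w by ring,
    show v - period - (t - period) = v - t by ring,
    show a + (t - period) - (w - period) = a + t - w by ring] at h2
  have h := h1.trans h2.symm
  simp only [sheetDiff]
  rw [← sub_eq_zero] at h ⊢
  rw [← h]
  abel

/-- The value of `sheetDiff u v`, as a function of `u`. -/
def sheetDiffOne (u : ℂ) : Phat := sheetDiff u (-log (1 - exp u))

theorem sheetDiffOne_eq {u v : ℂ} (h : Curve u v) : sheetDiffOne u = sheetDiff u v := by
  refine eq_of_additive sheetDiff_add ?_ h
  rw [Curve, neg_neg, exp_log (sub_ne_zero.2 h.exp_ne_one.symm)]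
  ring

theorem sheetDiffOne_add {a b : ℂ} (ha : exp a ≠ 1) (hb : exp b ≠ 1) (hab : exp (a + b) ≠ 1) :
    sheetDiffOne a + sheetDiffOne b = sheetDiffOne (a + b) := by
  obtain ⟨v, hv⟩ := Curve.exists_right ha
  obtain ⟨w, hw⟩ := Curve.exists_right hb
  obtain ⟨t, ht⟩ := Curve.exists_right hab
  rw [sheetDiffOne_eq hv, sheetDiffOne_eq hw, sheetDiffOne_eq ht, sheetDiff_add hv hw ht]

/-- The additive extension of `sheetDiffOne` to all of `ℂ`, as a function. -/
def braceFun (u : ℂ) : Phat :=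
  sheetDiffOne ((|u.re| + 1 : ℝ) : ℂ) + sheetDiffOne (u - ((|u.re| + 1 : ℝ) : ℂ))

/-- Additivity applies only off the multiples of `2πi`. Moving `s - r` from one summand to the other
changes the splitting, and a large real `r` keeps every argument involved away from those multiples.
-/
theorem sheetDiffOne_add_eq {u s : ℂ} (hs : exp s ≠ 1) (hus : exp (u - s) ≠ 1) {r : ℝ}
    (hr : |s.re| + |u.re| < r) :
    sheetDiffOne s + sheetDiffOne (u - s) = sheetDiffOne (r : ℂ) + sheetDiffOne (u - r) := by
  have h1 := abs_nonneg s.re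
  have h2 := abs_nonneg u.re
  have h3 : exp (r : ℂ) ≠ 1 := exp_ne_one_of_re_ne_zero (by rw [ofReal_re]; linarith)
  have h4 : exp (s - r) ≠ 1 := exp_ne_one_of_re_ne_zero (by
    rw [sub_re, ofReal_re]
    linarith [le_abs_self s.re])
  have h5 : exp (u - r) ≠ 1 := exp_ne_one_of_re_ne_zero (by
    rw [sub_re, ofReal_re]
    linarith [le_abs_self u.re])
  have e1 := sheetDiffOne_add h4 h3 (by rwa [sub_add_cancel])
  have e2 := sheetDiffOne_add hus h4 (by rwa [sub_add_sub_cancel])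
  rw [sub_add_cancel] at e1
  rw [sub_add_sub_cancel] at e2
  rw [← e1, ← e2]
  abel

theorem braceFun_eq {u s : ℂ} (hs : exp s ≠ 1) (hus : exp (u - s) ≠ 1) :
    braceFun u = sheetDiffOne s + sheetDiffOne (u - s) := by
  obtain ⟨r, hr⟩ := exists_gt (max (|s.re| + |u.re|) (|((|u.re| + 1 : ℝ) : ℂ).re| + |u.re|))
  rw [sheetDiffOne_add_eq hs hus ((le_max_left _ _).trans_lt hr), braceFun]
  have h := abs_nonneg u.re
  refine sheetDiffOne_add_eq (exp_ne_one_of_re_ne_zero ?_) (exp_ne_one_of_re_ne_zero ?_)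
    ((le_max_right _ _).trans_lt hr)
  · rw [ofReal_re]
    linarith
  · rw [sub_re, ofReal_re]
    linarith [le_abs_self u.re]

/-- The homomorphism `u ↦ [u, v] - [u, v - 2πi]` from `ℂ` to the extended pre-Bloch group. -/
def braceHom : ℂ →+ Phat :=
  AddMonoidHom.mk' braceFun fun a b => by
    have ha := abs_nonneg a.re
    have hb := abs_nonneg b.re
    have ha' := le_abs_self a.re
    have hb' := le_abs_self b.re
    obtain ⟨r, hr⟩ := exists_gt (|a.re| + |b.re|)
    have h0 : exp (r : ℂ) ≠ 1 := exp_ne_one_of_re_ne_zero (by rw [ofReal_re]; linarith)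
    have h1 : exp (r + r : ℂ) ≠ 1 := exp_ne_one_of_re_ne_zero (by
      rw [add_re, ofReal_re]
      linarith)
    have h2 : exp (a - r) ≠ 1 := exp_ne_one_of_re_ne_zero (by
      rw [sub_re, ofReal_re]
      linarith)
    have h3 : exp (b - r) ≠ 1 := exp_ne_one_of_re_ne_zero (by
      rw [sub_re, ofReal_re]
      linarith)
    have h4 : exp (a + b - (r + r)) ≠ 1 := exp_ne_one_of_re_ne_zero (by
      rw [sub_re, add_re, add_re, ofReal_re]
      linarith)
    rw [braceFun_eq h1 h4, braceFun_eq h0 h2, braceFun_eq h0 h3, ← sheetDiffOne_add h0 h0 h1,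
      show a + b - (r + r : ℂ) = a - r + (b - r) by ring,
      ← sheetDiffOne_add h2 h3 (by rwa [show a - r + (b - r) = a + b - (r + r : ℂ) by ring])]
    abel

theorem braceHom_eq {u v : ℂ} (h : Curve u v) : braceHom u = pt u v - pt u (v - period) := by
  obtain ⟨r, hr⟩ := exists_gt |u.re|
  have h0 := abs_nonneg u.re
  have h1 : exp (r : ℂ) ≠ 1 := exp_ne_one_of_re_ne_zero (by rw [ofReal_re]; linarith)
  have h2 : exp (u - r) ≠ 1 := exp_ne_one_of_re_ne_zero (by
    rw [sub_re, ofReal_re]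
    linarith [le_abs_self u.re])
  change braceFun u = sheetDiff u v
  rw [braceFun_eq h1 h2, sheetDiffOne_add h1 h2 (by rw [add_sub_cancel]; exact h.exp_ne_one),
    add_sub_cancel, sheetDiffOne_eq h]

theorem exists_third (a b : ℂ) : ∃ c, exp c ≠ 1 ∧ exp (a - c) ≠ 1 ∧ exp (c - b) ≠ 1 := by
  obtain ⟨r, hr⟩ := exists_gt (|a.re| + |b.re|)
  have ha := abs_nonneg a.re
  have hb := abs_nonneg b.re
  refine ⟨(r : ℂ), ?_, ?_, ?_⟩ <;> refine exp_ne_one_of_re_ne_zero ?_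
  · rw [ofReal_re]
    linarith
  · rw [sub_re, ofReal_re]
    linarith [le_abs_self a.re]
  · rw [sub_re, ofReal_re]
    linarith [le_abs_self b.re]

theorem eq_of_generic {A : Type*} {f : ℂ → ℂ → A}
    (hf : ∀ {a b v w}, Curve a v → Curve b w → exp (a - b) ≠ 1 → f a v = f b w)
    {a b v w : ℂ} (h : Curve a v) (h' : Curve b w) : f a v = f b w := by
  obtain ⟨c, hc, hac, hcb⟩ := exists_third a b
  obtain ⟨t, ht⟩ := Curve.exists_right hc
  exact (hf h ht hac).trans (hf ht h' hcb)

/-! ### First sheet differences and the vanishing of `braceHom` at `4πi` -/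

/-- The element `[u + 2πi, v] - [u, v] + braceHom v`, which turns out to be constant. -/
def firstSheetDefect (u v : ℂ) : Phat := pt (u + period) v - pt u v + braceHom v

theorem firstSheetDefect_eq {a b v w : ℂ} (ha : Curve a v) (hb : Curve b w) :
    firstSheetDefect a v = firstSheetDefect b w := by
  refine eq_of_generic (fun {a b v w} ha hb hab => ?_) ha hb
  -- Apart from the terms over `a` and `b`, raising the first logarithms of `a` and `b` by `2πi`
  -- affects only the term at `v - w`, whose second logarithm drops by `2πi`; the difference is
  -- `braceHom (v - w)`.
  obtain ⟨t, ht⟩ := Curve.exists_right hab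
  have hsum : Curve (a - b + b) v := by rwa [sub_add_cancel]
  have h1 := five_term_of_sum ht hb hsum
  have h2 := five_term_of_sum ht hb.add_period_left (by
    rw [← add_assoc]
    exact hsum.add_period_left)
  rw [sub_add_cancel] at h1
  rw [show a - b + (b + period) = a + period by ring,
    show t - v - (b + period) = t - v - b - period by ring] at h2
  have h3 : braceHom (v - w) = _ := braceHom_eq (u := v - w) (v := t - v - b) (by
    have hv : exp v * exp (-v) = 1 := by rw [← exp_add, add_neg_cancel, exp_zero]
    rw [Curve, sub_eq_add_neg, exp_add, show -(t - v - b) = -t + v + b by ring, exp_add, exp_add,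
      hb.exp_neg_eq, ht.exp_neg_eq]
    rw [ha.exp_neg_eq] at hv
    have hb' : exp (a - b) * exp b = exp a := by rw [← exp_add, sub_add_cancel]
    linear_combination hv - exp v * hb')
  rw [map_sub, sub_eq_iff_eq_add] at h3
  have h := h1.trans h2.symm
  simp only [firstSheetDefect]
  rw [h3]
  rw [← sub_eq_zero] at h ⊢
  rw [← h]
  abel

/-- Comparing the constant defect at `v` and `v - 2πi` gives `braceHom (b + period) - braceHom b =
-braceHom period`. -/
theorem braceHom_period_add_self : braceHom period + braceHom period = 0 := by
  obtain ⟨b, hb, -⟩ := exists_shift 0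
  obtain ⟨v, hv⟩ := Curve.exists_right hb
  have h1 := firstSheetDefect_eq hv hv.sub_period_right
  have h2 := braceHom_eq hv
  have h3 := braceHom_eq hv.add_period_left
  rw [map_add] at h3
  simp only [firstSheetDefect, map_sub] at h1
  rw [eq_sub_iff_add_eq] at h2 h3
  rw [← h3, ← h2] at h1
  rw [← sub_eq_zero] at h1
  rw [← h1]
  abel

/-! ### The symmetries generated by `z ↦ 1 / z` and `z ↦ 1 - z` -/

/-- The sum of the classes of a point and a point over its inverse. -/
def invSum (u v : ℂ) : Phat := pt u v + pt (-u) (u + v - period / 2)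

/-- Inverting all arguments interchanges the first two terms of `five_term_of_sum`, which have
opposite signs and cancel on adding the two relations. -/
theorem invSum_add {a b v w t : ℂ} (ha : Curve a v) (hb : Curve b w) (hab : Curve (a + b) t) :
    invSum a v + invSum b w = invSum (a + b) t := by
  have h1 := five_term_of_sum ha hb hab
  have h2 := five_term_of_sum ha.inv hb.inv (t := a + b + t - period / 2) (by
    rw [← neg_add]
    exact hab.inv)
  rw [show a + b + t - period / 2 - (b + w - period / 2) = a + t - w by ring,
    show a + v - period / 2 - (a + b + t - period / 2) - -b = v - t by ring,
    show -a + (a + b + t - period / 2) - (b + w - period / 2) = t - w by ring,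
    show a + v - period / 2 - (a + b + t - period / 2) = v - t - b by ring, ← neg_add] at h2
  simp only [invSum]
  rw [← sub_eq_zero, ← add_zero (0 : Phat)]
  nth_rewrite 1 [← h1]
  rw [← h2]
  abel

/-- With `u = 2s`, additivity along `-s + 2s = s` expresses the value at `2s` as the value at `s`
minus that at `-s`. Inverting twice lowers the second logarithm by `2πi`, so this difference is
`braceHom s`. -/
theorem invSum_eq {u v : ℂ} (h : Curve u v) : invSum u v = braceHom (u / 2) := by
  obtain ⟨s, rfl⟩ : ∃ s, u = s + s := ⟨u / 2, by ring⟩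
  have hs : exp s ≠ 1 := fun hs => h.exp_ne_one (by rw [exp_add, hs, one_mul])
  obtain ⟨x, hx⟩ := Curve.exists_right hs
  have h1 := invSum_add hx hx h
  have h2 := invSum_add hx.inv h (t := x) (by rwa [neg_add_cancel_left])
  have h3 : invSum (-s) (s + x - period / 2) = invSum s x - braceHom s := by
    rw [braceHom_eq hx, invSum, invSum, neg_neg,
      show -s + (s + x - period / 2) - period / 2 = x - period by ring]
    abel
  rw [neg_add_cancel_left, h3] at h2
  rw [show (s + s) / 2 = s by ring]
  rw [sub_add_eq_add_sub, sub_eq_iff_eq_add] at h2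
  exact add_left_cancel h2

theorem pt_inv {u v : ℂ} (h : Curve u v) :
    pt (-u) (u + v - period / 2) = -pt u v + braceHom (u / 2) := by
  rw [← invSum_eq h, invSum]
  abel

/-- Replacing `(x, y)` by `(1 - y, 1 - x)` reverses the last three terms of the five term relation,
so they cancel in the difference. -/
theorem pt_add_pt_one_sub_eq {a b v w : ℂ} (ha : Curve a v) (hb : Curve b w) :
    pt a v + pt (-v) (-a) = pt b w + pt (-w) (-b) := by
  refine eq_of_generic (f := fun u v => pt u v + pt (-v) (-u)) (fun {b a w v} hb ha hab => ?_) ha hb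
  obtain ⟨x, hx⟩ := Curve.exists_right hab
  have hw : exp w * exp (-w) = 1 := by rw [← exp_add, add_neg_cancel, exp_zero]
  have hba : exp a * exp (b - a) = exp b := by rw [← exp_add, add_sub_cancel]
  have h1 := five_term ha hb hx
  have h2 := five_term hb.one_sub ha.one_sub (v₂ := x - w - a) (by
    rw [show -v - -w = w + -v by ring, exp_add, show -(x - w - a) = -x + w + a by ring, exp_add,
      exp_add, hx.exp_neg_eq, ha.exp_neg_eq]
    rw [hb.exp_neg_eq] at hw
    linear_combination hw - exp w * hba)
  rw [show -v - -w = w - v by ring, show -a - -b = b - a by ring,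
    show w - v + (b - a) = b - a + (w - v) by ring, show x - w - a - -a = x - w by ring,
    show x - w - -w = x by ring] at h2
  have h := h1.trans h2.symm
  rw [← sub_eq_zero] at h ⊢
  rw [← neg_eq_zero, ← h]
  abel

theorem curve_sixth : Curve (period / 6) (period / 6) := by
  rw [Curve, show period / 6 = (Real.pi / 3 : ℝ) * I by rw [period]; push_cast; ring, ← neg_mul,
    ← two_cos, ← ofReal_cos, Real.cos_pi_div_three]
  norm_num

theorem pt_one_sub {u v : ℂ} (h : Curve u v) : pt (-v) (-u) = -pt u v + braceHom (period / 12) := by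
  have h1 := pt_add_pt_one_sub_eq h curve_sixth
  have h2 := pt_inv curve_sixth
  rw [show period / 6 + period / 6 - period / 2 = -(period / 6) by ring,
    show period / 6 / 2 = period / 12 by ring] at h2
  rw [h2] at h1
  rw [← sub_eq_zero] at h1 ⊢
  rw [← h1]
  abel

theorem pt_one_sub_inv {u v : ℂ} (h : Curve u v) :
    pt (-(u + v - period / 2)) u = pt u v - braceHom (u / 2 - period / 12) := by
  have := pt_one_sub h.inv
  rw [neg_neg, pt_inv h] at this
  rw [this, map_sub]
  abel

theorem pt_inv_one_sub {u v : ℂ} (h : Curve u v) :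
    pt v (-(u + v - period / 2)) = pt u v - braceHom (period / 12 - v / 2) := by
  -- The map `z ↦ 1 - 1 / z` has order three, and its square is `z ↦ 1 / (1 - z)`.
  have := pt_one_sub_inv h.inv.one_sub
  rw [show -(-(u + v - period / 2) + - -u - period / 2) = v by ring, neg_neg,
    pt_one_sub_inv h] at this
  rw [this, sub_sub, ← map_add]
  congr 2
  ring

theorem pt_div_sub_one {u v : ℂ} (h : Curve u v) :
    pt (u + v - period / 2) (-v) = -pt u v + braceHom (period / 6 - v / 2) := by
  have hc : Curve v (-(u + v - period / 2)) := by
    have := h.inv.one_sub.inv.one_sub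
    rwa [show -(-(u + v - period / 2) + - -u - period / 2) = v by ring, neg_neg] at this
  have := pt_one_sub hc
  rw [neg_neg, pt_inv_one_sub h, neg_sub] at this
  rw [this, show period / 6 - v / 2 = period / 12 - v / 2 + period / 12 by ring, map_add]
  abel

/-! ### From logarithms back to symbols and `χ̂` -/

theorem ne_zero_of_im_ne_zero {z : ℂ} (h : z.im ≠ 0) : z ≠ 0 := fun h' => h (by rw [h', zero_im])

theorem ne_one_of_im_ne_zero {z : ℂ} (h : z.im ≠ 0) : z ≠ 1 := fun h' => h (by rw [h', one_im])

theorem symb_eq_pt {z : ℂ} (h0 : z ≠ 0) (h1 : z ≠ 1) (p q : ℤ) :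
    symb z p q = pt (log z + period * p)
      (-(CutPlane.above z h0 h1).logOneSub + period * q) := by
  rw [symb, dif_pos ⟨h0, h1⟩, mk_eq_pt, Chat.logOne_mk, Chat.logTwo_mk, CutPlane.above_logZ]
  rfl

theorem symb_of_im_ne_zero {z : ℂ} (h : z.im ≠ 0) (p q : ℤ) :
    symb z p q = pt (log z + period * p) (-log (1 - z) + period * q) := by
  rw [symb_eq_pt (ne_zero_of_im_ne_zero h) (ne_one_of_im_ne_zero h),
    CutPlane.above_of_im_ne_zero _ _ h]
  rfl

theorem exp_period_mul (n : ℤ) : exp (period * n) = 1 := by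
  rw [mul_comm]
  exact exp_int_mul_two_pi_mul_I n

theorem brace_eq {z : ℂ} (h0 : z ≠ 0) (h1 : z ≠ 1) (p : ℤ) :
    brace z p = braceHom (log z + period * p) := by
  have hc : Curve (log z + period * p)
      (-(CutPlane.above z h0 h1).logOneSub + period * ((1 : ℤ) : ℂ)) := by
    rw [Curve, exp_add, exp_period_mul, mul_one, exp_log h0, neg_add, neg_neg, exp_add,
      CutPlane.exp_logOneSub, CutPlane.above_toComplex, exp_neg, exp_period_mul]
    ring
  rw [braceHom_eq hc, brace, symb_eq_pt h0 h1, symb_eq_pt h0 h1]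
  congr 2
  push_cast
  ring

theorem kappaHat_eq : kappaHat = braceHom period := by
  rw [kappaHat, brace_eq (by norm_num) (by norm_num), brace_eq (by norm_num) (by norm_num),
    ← map_sub]
  congr 1
  push_cast
  ring

theorem braceHom_two_period_mul (n : ℤ) : braceHom (2 * period * n) = 0 := by
  rw [mul_comm, ← zsmul_eq_mul, map_zsmul, two_mul, map_add, braceHom_period_add_self, smul_zero]

theorem braceHom_congr {u v : ℂ} (n : ℤ) (h : u = v + 2 * period * n) :
    braceHom u = braceHom v := by
  rw [h, map_add, braceHom_two_period_mul, add_zero]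

theorem log_sq_eq {z : ℂ} (hz : z ≠ 0) : ∃ k : ℤ, log (z ^ 2) = 2 * log z + period * k ∧
    (z ^ 2).arg = 2 * z.arg + 2 * Real.pi * k := by
  have h : exp (log (z ^ 2)) = exp (2 * log z) := by
    rw [exp_log (pow_ne_zero 2 hz), two_mul, exp_add, exp_log hz, sq]
  obtain ⟨k, hk⟩ := exp_eq_exp_iff_exists_int.1 h
  refine ⟨k, by rw [hk, period]; ring, ?_⟩
  have := congrArg im hk
  simp [log_im] at this
  rw [this]
  ring

/-- Only `2 * s` modulo `4πi` matters. The principal logarithm of `z ^ 2` is `2 * log z` for `arg z`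
in `(-π/2, π/2]` and differs from it by `±2πi` otherwise; the extra `2πi` in the last clause of `χ̂`
turns this into `0` or `4πi`. -/
theorem chiHat_exp (s : ℂ) : chiHat (exp s) = braceHom (2 * s) := by
  unfold chiHat
  split_ifs with h1 h2 h3
  · obtain ⟨n, hn⟩ := exp_eq_one_iff.1 h1
    rw [braceHom_congr (v := 0) n (by rw [hn, period]; ring), map_zero]
  · have : exp s = exp (period / 2) := by rw [h2, exp_half_period]
    obtain ⟨n, hn⟩ := exp_eq_exp_iff_exists_int.1 this
    rw [kappaHat_eq, braceHom_congr n (u := 2 * s) (v := period) (by rw [hn, period]; ring)]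
  all_goals
    have hs : exp s ^ 2 ≠ 1 := fun h =>
      (mul_self_eq_one_iff.1 (by rwa [← sq])).elim h1 h2
    obtain ⟨k, hk, harg⟩ := log_sq_eq (exp_ne_zero s)
    obtain ⟨m, hm⟩ := exp_eq_exp_iff_exists_int.1 (exp_log (exp_ne_zero s))
    have hpi := Real.pi_pos
    have l1 := neg_pi_lt_arg (exp s ^ 2)
    have l2 := arg_le_pi (exp s ^ 2)
    have l3 := neg_pi_lt_arg (exp s)
    have l4 := arg_le_pi (exp s)
    rw [brace_eq (pow_ne_zero 2 (exp_ne_zero s)) hs, hk, hm]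
    rw [harg] at l1 l2
  · obtain rfl : k = 0 := by
      have hk1 : (-1 : ℝ) < k := by nlinarith [h3.1, h3.2]
      have hk2 : (k : ℝ) < 1 := by nlinarith [h3.1, h3.2]
      norm_cast at hk1 hk2
      lia
    refine braceHom_congr m ?_
    rw [period]
    push_cast
    ring
  · have hk' : k = 1 ∨ k = -1 := by
      by_cases h4 : -(Real.pi / 2) < (exp s).arg
      · right
        have h5 : Real.pi / 2 < (exp s).arg := not_le.1 fun h5 => h3 ⟨h4, h5⟩
        have hk1 : (-2 : ℝ) < k := by nlinarith
        have hk2 : (k : ℝ) < 0 := by nlinarith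
        norm_cast at hk1 hk2
        lia
      · left
        have hk1 : (0 : ℝ) < k := by nlinarith
        have hk2 : (k : ℝ) < 2 := by nlinarith
        norm_cast at hk1 hk2
        lia
    rcases hk' with rfl | rfl
    · refine braceHom_congr (m + 1) ?_
      rw [period]
      push_cast
      ring
    · refine braceHom_congr m ?_
      rw [period]
      push_cast
      ring

theorem exp_quarter_log {z : ℂ} (hz : z ≠ 0) : fourthRoot z = exp (log z / 4) := by
  rw [fourthRoot, cpow_def_of_ne_zero hz]
  congr 1
  ring

theorem I_zpow (p : ℤ) : I ^ p = exp (period * p / 4) := by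
  have : I = exp (period / 4) := by
    rw [period, show 2 * Real.pi * I / 4 = Real.pi / 2 * I by ring, exp_pi_div_two_mul_I]
  rw [this, ← exp_int_mul]
  congr 1
  ring

theorem log_eq_of_exp {z w : ℂ} (h : exp w = z) (h1 : -Real.pi < w.im) (h2 : w.im < Real.pi) :
    log z = w := by
  rw [← h, log_exp h1 h2.le]

end

end ExtendedBloch

open ExtendedBloch in
theorem proposition5p1 (z : ℂ) (hz : 0 < z.im) (p q : ℤ) :
    symb (1 / z) (-p) (p + q)
      = -symb z p q + chiHat (Complex.I ^ p * fourthRoot z) ∧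
    symb (1 - 1 / z) (-p - q) p
      = symb z p q
        - chiHat (Complex.exp (-(Real.pi * Complex.I / 12) * (1 - 6 * (p : ℂ))) * fourthRoot z) ∧
    symb (-z / (1 - z)) (p + q) (-q)
      = -symb z p q
        + chiHat (Complex.exp (-(Real.pi * Complex.I / 12) * (1 + 6 * (q : ℂ)))
            * fourthRoot (z - 1)) ∧
    symb (1 / (1 - z)) q (-p - q)
      = symb z p q
        - chiHat (Complex.exp (-(Real.pi * Complex.I / 12) * (2 + 6 * (q : ℂ)))
            * fourthRoot (z - 1)) ∧
    symb (1 - z) (-q) (-p)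
      = -symb z p q + chiHat (Complex.exp (Real.pi * Complex.I / 12)) := by
  have hz0 : z ≠ 0 := ne_zero_of_im_ne_zero hz.ne'
  have him : (1 - z).im < 0 := by simpa using hz
  have hz1 : 1 - z ≠ 0 := ne_zero_of_im_ne_zero him.ne
  have hz1' : z - 1 ≠ 0 := fun h => hz1 (by linear_combination -h)
  have arg0 : 0 < (Complex.log z).im ∧ (Complex.log z).im < Real.pi := by
    rw [Complex.log_im]
    exact ⟨lt_of_le_of_ne (Complex.arg_nonneg_iff.2 hz.le)
      fun h => hz.ne' (Complex.arg_eq_zero_iff.1 h.symm).2,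
      lt_of_le_of_ne (Complex.arg_le_pi z) fun h => hz.ne' (Complex.arg_eq_pi_iff.1 h).2⟩
  have arg1 : -Real.pi < (Complex.log (1 - z)).im ∧ (Complex.log (1 - z)).im < 0 := by
    rw [Complex.log_im]
    exact ⟨Complex.neg_pi_lt_arg _, Complex.arg_neg_iff.2 him⟩
  have e0 : Complex.exp (Complex.log z) = z := Complex.exp_log hz0
  have e1 : Complex.exp (Complex.log (1 - z)) = 1 - z := Complex.exp_log hz1
  have hp : (period / 2).im = Real.pi := by
    rw [period, show 2 * Real.pi * Complex.I / 2 = Real.pi * Complex.I by ring]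
    simp
  have hh := exp_half_period
  set L := Complex.log z with hL
  set M := Complex.log (1 - z) with hM
  -- Since `0 < Im L < π` and `-π < Im M < 0`, each of these combinations has imaginary part
  -- strictly between `-π` and `π`, hence is principal.
  have log_a : Complex.log (1 / z) = -L :=
    log_eq_of_exp (by rw [Complex.exp_neg, e0, one_div])
      (by rw [Complex.neg_im]; linarith) (by rw [Complex.neg_im]; linarith)
  have log_b : Complex.log (1 - 1 / z) = M - L + period / 2 :=
    log_eq_of_exp (by rw [Complex.exp_add, Complex.exp_sub, e0, e1, hh]; field_simp; ring)
      (by rw [Complex.add_im, Complex.sub_im, hp]; linarith)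
      (by rw [Complex.add_im, Complex.sub_im, hp]; linarith)
  have log_c : Complex.log (-z / (1 - z)) = L - M - period / 2 :=
    log_eq_of_exp (by rw [Complex.exp_sub, Complex.exp_sub, e0, e1, hh]; field_simp)
      (by rw [Complex.sub_im, Complex.sub_im, hp]; linarith)
      (by rw [Complex.sub_im, Complex.sub_im, hp]; linarith)
  have log_d : Complex.log (1 / (1 - z)) = -M :=
    log_eq_of_exp (by rw [Complex.exp_neg, e1, one_div])
      (by rw [Complex.neg_im]; linarith) (by rw [Complex.neg_im]; linarith)
  have log_e : Complex.log (z - 1) = M + period / 2 :=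
    log_eq_of_exp (by rw [Complex.exp_add, e1, hh]; ring)
      (by rw [Complex.add_im, hp]; linarith) (by rw [Complex.add_im, hp]; linarith)
  have sub_c : 1 - -z / (1 - z) = 1 / (1 - z) := by field_simp; ring
  have sub_d : 1 - 1 / (1 - z) = -z / (1 - z) := by field_simp; ring
  have im_a : (1 / z).im ≠ 0 := by
    simp [hz.ne', hz0]
  have im_b : (1 - 1 / z).im ≠ 0 := by simpa using im_a
  have im_d : (1 / (1 - z)).im ≠ 0 := by
    have := him.ne
    simp only [one_div, Complex.inv_im]
    exact div_ne_zero (neg_ne_zero.2 this) (Complex.normSq_pos.2 hz1).ne'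
  have im_c : (-z / (1 - z)).im ≠ 0 := by
    rw [← sub_d]
    simpa using im_d
  have hc : Curve (L + period * p) (-M + period * q) := by
    rw [Curve, neg_add, neg_neg, Complex.exp_add, Complex.exp_add, Complex.exp_neg (period * q),
      exp_period_mul, exp_period_mul, e0, e1]
    ring
  have hchi (s t : ℂ) : chiHat (Complex.exp s * Complex.exp t) = braceHom (2 * (s + t)) := by
    rw [← Complex.exp_add, chiHat_exp]
  have hpi : (Real.pi : ℂ) * Complex.I = period / 2 := by
    rw [period]
    ring
  rw [symb_of_im_ne_zero hz.ne', symb_of_im_ne_zero im_a, symb_of_im_ne_zero im_b,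
    symb_of_im_ne_zero im_c, symb_of_im_ne_zero im_d, symb_of_im_ne_zero him.ne, sub_sub_cancel,
    sub_sub_cancel, sub_c, sub_d, log_a, log_b, log_c, log_d, ← hL, ← hM, exp_quarter_log hz0,
    exp_quarter_log hz1', log_e, I_zpow, hchi, hchi, hchi, hchi, chiHat_exp, hpi, ← hL]
  -- Each formula is now a symmetry at the point `(L + 2πip, -M + 2πiq)`, and the arguments agree as
  -- linear expressions in `L`, `M`, `p`, `q` and the period.
  refine ⟨?_, ?_, ?_, ?_, ?_⟩
  · convert pt_inv hc using 2 <;> push_cast <;>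
      first | ring1 | (refine congrArg braceHom ?_; ring)
  · convert pt_one_sub_inv hc using 2 <;> push_cast <;>
      first | ring1 | (refine congrArg braceHom ?_; ring)
  · convert pt_div_sub_one hc using 2 <;> push_cast <;>
      first | ring1 | (refine congrArg braceHom ?_; ring)
  · convert pt_inv_one_sub hc using 2 <;> push_cast <;>
      first | ring1 | (refine congrArg braceHom ?_; ring)
  · convert pt_one_sub hc using 2 <;> push_cast <;>
      first | ring1 | (refine congrArg braceHom ?_; ring)
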